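/- Let $n\ge 2$, $k\ge 4$ and $s\ge 2$ be integers, write $n-1=r(k-2)+t$ with integers $r\ge 0$ and $0\le t\le k-3$, and put $$\psi_s(n,k)=r\binom{k-1}{s}+\binom{t+1}{s}.$$ For a finite simple graph $G$ let $N_s(G)$ be the number of $s$-cliques of $G$ (complete subgraphs with $s$ vertices). Then: (i) If $G$ is a connected graph on $n$ vertices that has no cycle of length at least $k$, then $N_s(G)\le\psi_s(n,k)$. (ii) This sharpens Luo's clique version of the Erdős–Gallai bound: $\psi_s(n,k)\le\frac{n-1}{k-2}\binom{k-1}{s}$, and the inequality is strict whenever $k-2$ does not divide $n-1$ and $s\le k-1$. (iii) The bound in (i) is attained by the $n$-vertex graph $Q_{n,k}$ that consists of a vertex $w$, $r$ cliques with $k-2$ vertices each and one clique with $t$ vertices, all pairwise disjoint and with no edges between different cliques, together with all edges from $w$ to the vertices of these cliques: $Q_{n,k}$ is connected, has no cycle of length at least $k$, and $N_s(Q_{n,k})=\psi_s(n,k)$. -/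

import Mathlib

namespace CliqueCircumference

/-- `N_s(G)`: the number of `s`-cliques of `G`, a clique being identified with its vertex set. -/
noncomputable def numCliques {V : Type*} (G : SimpleGraph V) (s : ℕ) : ℕ :=
  (G.cliqueSet s).ncard

/-- `G` has no cycle of length at least `k`. -/
def NoCycleOfLengthAtLeast {V : Type*} (G : SimpleGraph V) (k : ℕ) : Prop :=
  ∀ (v : V) (c : G.Walk v v), c.IsCycle → c.length < k

/-- The graph `X_{n,k}`: the vertices `0` and `1` form the edge `uv` and are joined to everything;
the other `n - 2 = r (k - 3) + t` vertices are cut into consecutive blocks of size `k - 3`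
(`r` full blocks and a last block of `t` vertices), each block being a clique, with no edges
between different blocks. -/
def graphX (n k : ℕ) : SimpleGraph (Fin n) where
  Adj i j := i ≠ j ∧ (i.val < 2 ∨ j.val < 2 ∨ (i.val - 2) / (k - 3) = (j.val - 2) / (k - 3))
  symm := ⟨fun _ _ h => ⟨h.1.symm, by have := h.2; tauto⟩⟩
  loopless := ⟨fun _ h => h.1 rfl⟩

/-- The graph `Q_{n,k}`: the vertex `0` (called `w`) is joined to everything; the other
`n - 1 = r (k - 2) + t` vertices are cut into consecutive blocks of size `k - 2` (`r` full blocks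
and a last block of `t` vertices), each block being a clique, with no edges between different
blocks. -/
def graphQ (n k : ℕ) : SimpleGraph (Fin n) where
  Adj i j := i ≠ j ∧ (i.val = 0 ∨ j.val = 0 ∨ (i.val - 1) / (k - 2) = (j.val - 1) / (k - 2))
  symm := ⟨fun _ _ h => ⟨h.1.symm, by have := h.2; tauto⟩⟩
  loopless := ⟨fun _ h => h.1 rfl⟩

/-- `Q_{n,k}` is the graph obtained from `X_{n+1,k+1}` by contracting the edge `uv` between the
vertices `0` and `1`: the map `i ↦ i - 1` is onto, identifies precisely these two vertices, and two
distinct vertices of `Q_{n,k}` are adjacent exactly if some preimages of them are adjacent. -/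
theorem graphQ_adj_iff_contract (n k : ℕ) (a b : Fin n) :
    (graphQ n k).Adj a b ↔ a ≠ b ∧ ∃ i j : Fin (n + 1),
      i.val - 1 = a.val ∧ j.val - 1 = b.val ∧ (graphX (n + 1) (k + 1)).Adj i j := by
  have e : k + 1 - 3 = k - 2 := by omega
  simp only [graphQ, graphX, e]
  refine and_congr_right fun hab => ?_
  have hab' : a.val ≠ b.val := fun h => hab (Fin.ext h)
  constructor
  · intro h
    refine ⟨a.succ, b.succ, by simp, by simp, by simpa using hab, ?_⟩
    rcases h with h | h | h
    · left; simp [h]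
    · right; left; simp [h]
    · right; right; simpa using h
  · rintro ⟨i, j, hi, hj, -, h | h | h⟩
    · left; omega
    · right; left; omega
    · right; right
      rw [← hi, ← hj]
      simpa [Nat.sub_sub] using h

end CliqueCircumference

/-! The upper bound is Kopylov's argument run for cliques, by induction on the number of vertices.
Adding edges never destroys cliques, so the graph may be taken edge-maximal without cycles of length
at least `k`; then non-adjacent vertices are ends of a path on at least `k` vertices
(`ShortCycles.exists_saturated`). If a vertex separates the graph, every clique lies in one of two
sides sharing only that vertex, and superadditivity (`psi_add_le`) adds up the inductive bounds.

Otherwise the ends of a path on at least `k` vertices have fewer than `k` neighbours on it, counted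
together (`card_adj_add_card_adj_lt`). A longest such path with non-adjacent ends then shows that
two sets whose inner minimum degrees sum to at least `k` are completely joined (`adj_of_minDegree`).
Hence the core left after deleting vertices of degree at most `d = (k - 1) / 2` is empty or a clique
on `h < k` vertices; in the second case vertices of degree at most `k - h` can be deleted until `h`
remain. Each deletion order bounds the number of cliques, and convexity of binomial coefficients
puts both bounds below `psi`.

The comparison with Luo's bound is the monotonicity of `C(j + 1, s) / j` in `j`. In `graphQ` a cycle
meets vertex `0` at most once, so it stays in one block; the blocks supply enough cliques, and the
general upper bound gives equality. -/

namespace CliqueCircumference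

/-! ### Paths recorded by their vertex sets, and a pair of disjoint paths across a 2-connected
graph. -/

section Paths

variable {V : Type*} [DecidableEq V] {G : SimpleGraph V}

/-- `PathOn G u v S`: there is a path of `G` from `u` to `v` whose vertex set is `S`. -/
inductive PathOn (G : SimpleGraph V) : V → V → Finset V → Prop
  | single (u : V) : PathOn G u u {u}
  | cons {u v w : V} {S : Finset V} : G.Adj u v → u ∉ S → PathOn G v w S →
      PathOn G u w (insert u S)

namespace PathOn

theorem left_mem {u v : V} {S : Finset V} (h : PathOn G u v S) : u ∈ S := by
  cases h <;> simp

theorem right_mem {u v : V} {S : Finset V} (h : PathOn G u v S) : v ∈ S := by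
  induction h <;> simp_all

theorem append {u v w : V} {S T : Finset V} (h : PathOn G u v S) (h' : PathOn G v w T)
    (hST : ∀ z ∈ S, z ∈ T → z = v) : PathOn G u w (S ∪ T) := by
  induction h with
  | single u =>
    have : {u} ∪ T = T := by
      simpa using h'.left_mem
    rwa [this]
  | @cons u a v S hadj hu hp ih =>
    rw [Finset.insert_union]
    refine .cons hadj ?_ (ih h' fun z hz hz' => hST z (Finset.mem_insert_of_mem hz) hz')
    rw [Finset.mem_union, not_or]
    refine ⟨hu, fun hT => hu ?_⟩
    rw [hST u (Finset.mem_insert_self _ _) hT]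
    exact hp.right_mem

theorem append_edge {u v v' w : V} {S T : Finset V} (h : PathOn G u v S) (hadj : G.Adj v v')
    (h' : PathOn G v' w T) (hST : Disjoint S T) : PathOn G u w (S ∪ T) := by
  have hv : v ∉ T := Finset.disjoint_left.1 hST h.right_mem
  have := h.append (.cons hadj hv h') (fun z hz hz' => by
    rcases Finset.mem_insert.1 hz' with rfl | hz'
    · rfl
    · exact absurd hz' (Finset.disjoint_left.1 hST hz))
  rwa [Finset.union_insert, Finset.insert_eq_self.2 (Finset.mem_union_left _ h.right_mem)] at this

theorem reverse {u v : V} {S : Finset V} (h : PathOn G u v S) : PathOn G v u S := by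
  induction h with
  | single u => exact .single u
  | @cons u a v S hadj hu hp ih =>
    have := ih.append_edge hadj.symm (.single u) (by simpa using hu)
    rwa [Finset.union_comm] at this

theorem concat {u v w : V} {S : Finset V} (h : PathOn G u v S) (hadj : G.Adj v w)
    (hw : w ∉ S) : PathOn G u w (insert w S) :=
  (PathOn.cons hadj.symm hw h.reverse).reverse

theorem split {u v z : V} {S : Finset V} (h : PathOn G u v S) (hz : z ∈ S) :
    ∃ S₁ S₂, PathOn G u z S₁ ∧ PathOn G z v S₂ ∧ S₁ ∪ S₂ = S ∧ ∀ y ∈ S₁, y ∈ S₂ → y = z := by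
  induction h with
  | single u =>
    obtain rfl : z = u := by simpa using hz
    exact ⟨{z}, {z}, .single z, .single z, by simp, by simp⟩
  | @cons u a v S hadj hu hp ih =>
    by_cases hzu : z = u
    · subst hzu
      exact ⟨{z}, insert z S, .single z, .cons hadj hu hp, by simp, by simp⟩
    · obtain ⟨S₁, S₂, h₁, h₂, rfl, h₃⟩ := ih (by simpa [hzu] using hz)
      rw [Finset.mem_union, not_or] at hu
      refine ⟨insert u S₁, S₂, .cons hadj hu.1 h₁, h₂, by simp, fun y hy hy' => ?_⟩
      rcases Finset.mem_insert.1 hy with rfl | hy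
      · exact absurd hy' hu.2
      · exact h₃ y hy hy'

/-- Follow a path until it first meets `Z`. -/
theorem exists_first_hit {u v : V} {S Z : Finset V} (h : PathOn G u v S) (hv : v ∈ Z) :
    ∃ z ∈ Z, ∃ R ⊆ S, PathOn G u z R ∧ ∀ y ∈ R, y ∈ Z → y = z := by
  induction h with
  | single u => exact ⟨u, hv, {u}, subset_rfl, .single u, by simp⟩
  | @cons u a v S hadj hu hp ih =>
    by_cases hz : u ∈ Z
    · exact ⟨u, hz, {u}, by simp, .single u, by simp⟩
    · obtain ⟨z, hzZ, R, hRS, hR, hRZ⟩ := ih hv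
      refine ⟨z, hzZ, insert u R, Finset.insert_subset_insert _ hRS,
        .cons hadj (fun h => hu (hRS h)) hR, fun y hy hyZ => ?_⟩
      rcases Finset.mem_insert.1 hy with rfl | hy
      · exact absurd hyZ hz
      · exact hRZ y hy hyZ

/-- A path from `X` to `Z` contains a path from `X` to `Z` without inner vertices in `X ∪ Z`. -/
theorem exists_trim {u v : V} {S X Z : Finset V} (h : PathOn G u v S) (hu : u ∈ X)
    (hv : v ∈ Z) : ∃ x ∈ X, ∃ z ∈ Z, ∃ R ⊆ S, PathOn G x z R ∧
      (∀ y ∈ R, y ∈ X → y = x) ∧ ∀ y ∈ R, y ∈ Z → y = z := by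
  obtain ⟨z, hz, R, hRS, hR, hRZ⟩ := h.exists_first_hit hv
  obtain ⟨x, hx, R', hRR', hR', hRX⟩ := hR.reverse.exists_first_hit hu
  exact ⟨x, hx, z, hz, R', hRR'.trans hRS, hR'.reverse, hRX, fun y hy => hRZ y (hRR' hy)⟩

theorem exists_walk {u v : V} {S : Finset V} (h : PathOn G u v S) :
    ∃ q : G.Walk u v, q.IsPath ∧ q.support.toFinset = S := by
  induction h with
  | single u => exact ⟨.nil, by simp, by simp⟩
  | @cons u a v S hadj hu hp ih =>
    obtain ⟨q, hq, rfl⟩ := ih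
    exact ⟨.cons hadj q, by simpa [hq] using hu, by simp⟩

theorem of_induce {A : Set V} {u v : A} {S : Finset A} (h : PathOn (G.induce A) u v S) :
    PathOn G (u : V) v (S.map (Function.Embedding.subtype _)) := by
  induction h with
  | single u => simpa using PathOn.single (G := G) (u : V)
  | @cons u a v S hadj hu hp ih =>
    rw [Finset.map_insert]
    exact .cons (by simpa using hadj) (by simpa using hu) ih

/-- A path in `G` with an additional edge `xy` either lives in `G` or splits at this edge. -/
theorem of_sup_edge {x y u v : V} {S : Finset V} (h : PathOn (G ⊔ SimpleGraph.edge x y) u v S) :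
    PathOn G u v S ∨ ∃ S₁ S₂, Disjoint S₁ S₂ ∧ S₁ ∪ S₂ = S ∧
      (PathOn G u x S₁ ∧ PathOn G y v S₂ ∨ PathOn G u y S₁ ∧ PathOn G x v S₂) := by
  induction h with
  | single u => exact .inl (.single u)
  | @cons u a v S hadj hu hp ih =>
    have hcase : G.Adj u a ∨ (u = x ∧ a = y) ∨ (u = y ∧ a = x) := by
      rw [SimpleGraph.sup_adj, SimpleGraph.edge_adj] at hadj
      grind
    rcases ih with ih | ⟨S₁, S₂, hd, rfl, ih⟩
    · rcases hcase with h | ⟨rfl, rfl⟩ | ⟨rfl, rfl⟩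
      · exact .inl (.cons h hu ih)
      · exact .inr ⟨{u}, S, by simpa using hu, rfl, .inl ⟨.single _, ih⟩⟩
      · exact .inr ⟨{u}, S, by simpa using hu, rfl, .inr ⟨.single _, ih⟩⟩
    · rw [Finset.mem_union, not_or] at hu
      rcases hcase with h | ⟨rfl, rfl⟩ | ⟨rfl, rfl⟩
      · refine .inr ⟨insert u S₁, S₂, by simp [hd, hu.2], by simp, ?_⟩
        exact ih.imp (And.imp_left (.cons h hu.1)) (And.imp_left (.cons h hu.1))
      · rcases ih with ih | ih
        · exact absurd ih.1.right_mem hu.1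
        · exact absurd ih.2.left_mem hu.2
      · rcases ih with ih | ih
        · exact absurd ih.2.left_mem hu.2
        · exact absurd ih.1.right_mem hu.1

/-- The vertices of a path in order. -/
theorem exists_enum {u v : V} {S : Finset V} (h : PathOn G u v S) :
    ∃ (L : ℕ) (f : ℕ → V), f 0 = u ∧ f L = v ∧ (∀ i < L, G.Adj (f i) (f (i + 1))) ∧
      Set.InjOn f (Set.Iic L) ∧ S = (Finset.range (L + 1)).image f := by
  induction h with
  | single u => exact ⟨0, fun _ => u, rfl, rfl, by simp, fun a ha b hb _ => by simp_all, by simp⟩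
  | @cons u a v S hadj hu hp ih =>
    obtain ⟨L, f, h0, hL, hf, hinj, rfl⟩ := ih
    have hu' : ∀ i ≤ L, f i ≠ u := fun i hi h => hu (Finset.mem_image.2 ⟨i, Finset.mem_range.2 (by omega), h⟩)
    refine ⟨L + 1, fun i => Nat.casesOn i u f, rfl, hL, ?_, ?_, ?_⟩
    · rintro (_ | i) hi
      · change G.Adj u (f 0)
        rwa [h0]
      · exact hf i (by omega)
    · rintro (_ | i) hi (_ | j) hj hij
      · rfl
      · exact absurd hij.symm (hu' j (Nat.succ_le_succ_iff.1 hj))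
      · exact absurd hij (hu' i (Nat.succ_le_succ_iff.1 hi))
      · rw [hinj (Nat.succ_le_succ_iff.1 hi) (Nat.succ_le_succ_iff.1 hj) hij]
    · rw [Finset.range_add_one' (L + 1), Finset.image_insert, Finset.map_eq_image,
        Finset.image_image]
      rfl

theorem segment {L : ℕ} {f : ℕ → V} (hf : ∀ i < L, G.Adj (f i) (f (i + 1)))
    (hinj : Set.InjOn f (Set.Iic L)) {i j : ℕ} (hij : i ≤ j) (hj : j ≤ L) :
    PathOn G (f i) (f j) ((Finset.Icc i j).image f) := by
  obtain ⟨m, rfl⟩ := Nat.exists_eq_add_of_le hij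
  clear hij
  induction m generalizing i with
  | zero => simpa using PathOn.single (G := G) (f i)
  | succ m ih =>
    have h := ih (i := i + 1) (by omega)
    rw [show i + 1 + m = i + (m + 1) by omega] at h
    have e : Finset.Icc i (i + (m + 1)) = insert i (Finset.Icc (i + 1) (i + (m + 1))) := by
      ext; simp; omega
    rw [e, Finset.image_insert]
    refine .cons (hf i (by omega)) (fun hmem => ?_) h
    obtain ⟨a, ha, hfa⟩ := Finset.mem_image.1 hmem
    rw [Finset.mem_Icc] at ha
    have := hinj (show a ≤ L by omega) (show i ≤ L by omega) hfa
    omega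

end PathOn

/-- `k` exceeds the number of vertices of every path with adjacent ends. -/
def ShortCycles (G : SimpleGraph V) (k : ℕ) : Prop :=
  ∀ ⦃u v : V⦄ ⦃S : Finset V⦄, PathOn G u v S → G.Adj v u → S.card < k

/-- A path on at least three vertices does not use the edge between its ends, so that edge closes it
to a genuine cycle of length the number of vertices. -/
theorem NoCycleOfLengthAtLeast.shortCycles {k : ℕ} (hk : 3 ≤ k)
    (h : NoCycleOfLengthAtLeast G k) : ShortCycles G k := by
  intro u v S hS hadj
  by_contra! hcard
  obtain ⟨q, hq, rfl⟩ := hS.exists_walk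
  rw [List.toFinset_card_of_nodup hq.support_nodup, SimpleGraph.Walk.length_support] at hcard
  have hc : (SimpleGraph.Walk.cons hadj q).IsCycle := by
    refine (SimpleGraph.Walk.cons_isCycle_iff _ _).2 ⟨hq, fun hmem => ?_⟩
    have := hq.length_eq_one_of_mem_edges (by rwa [Sym2.eq_swap])
    omega
  have := h _ _ hc
  simp at this
  omega

theorem ShortCycles.induce {k : ℕ} (h : ShortCycles G k) (A : Set V) :
    ShortCycles (G.induce A) k := by
  intro u v S hS hadj
  simpa using h hS.of_induce (by simpa using hadj)

/-- Two internally disjoint paths with the same ends form a cycle. -/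
theorem ShortCycles.card_union_lt {k : ℕ} (hG : ShortCycles G k) {u v : V} {S T : Finset V}
    (hS : PathOn G u v S) (hT : PathOn G u v T) (huv : u ≠ v)
    (hST : ∀ z ∈ S, z ∈ T → z = u ∨ z = v) : (S ∪ T).card < k := by
  cases hT with
  | single => exact absurd rfl huv
  | @cons _ a _ T hadj hu hp =>
    have h := hS.append hp.reverse fun z hz hz' => by
      rcases hST z hz (Finset.mem_insert_of_mem hz') with rfl | rfl
      · exact absurd hz' hu
      · rfl
    have e : S ∪ insert u T = S ∪ T := by
      rw [Finset.union_insert, Finset.insert_eq_self.2 (Finset.mem_union_left _ hS.left_mem)]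
    rw [e]
    exact hG h hadj.symm

/-- No single vertex separates `G`. -/
def NoCutVertex (G : SimpleGraph V) : Prop :=
  ∀ ⦃w u v : V⦄, u ≠ w → v ≠ w → ∃ S, PathOn G u v S ∧ w ∉ S

/-- If no vertex separates `G`, a path from `X` to `Y` can be replaced by two disjoint ones
in such a way that its ends remain ends. -/
theorem NoCutVertex.exists_disjoint_paths (hG : NoCutVertex G) {s t : V} {S : Finset V}
    (hS : PathOn G s t S) {X Y : Finset V} (hsX : s ∈ X) (htY : t ∈ Y)
    (hSX : ∀ z ∈ S, z ∈ X → z = s) (hSY : ∀ z ∈ S, z ∈ Y → z = t)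
    (hX : ∃ x ∈ X, x ≠ s) (hY : ∃ y ∈ Y, y ≠ t) :
    ∃ x ∈ X, x ≠ s ∧ ∃ y ∈ Y, y ≠ t ∧ ∃ A B, Disjoint A B ∧
      (∀ z ∈ A ∪ B, z ∈ X → z = s ∨ z = x) ∧ (∀ z ∈ A ∪ B, z ∈ Y → z = t ∨ z = y) ∧
      (PathOn G s t A ∧ PathOn G x y B ∨ PathOn G s y A ∧ PathOn G x t B) := by
  induction hS generalizing X with
  | single s =>
    obtain ⟨x, hx, hxs⟩ := hX
    obtain ⟨y, hy, hys⟩ := hY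
    obtain ⟨T, hT, hsT⟩ := hG hxs hys
    obtain ⟨x, hx, y, hy, R, hRT, hR, hRX, hRY⟩ := hT.exists_trim hx hy
    have hsR : s ∉ R := fun h => hsT (hRT h)
    have hxs : x ≠ s := fun h => hsR (h ▸ hR.left_mem)
    have hys : y ≠ s := fun h => hsR (h ▸ hR.right_mem)
    exact ⟨x, hx, hxs, y, hy, hys, {s}, R, by simpa using hsR, by grind, by grind,
      .inl ⟨.single s, hR⟩⟩
  | @cons s w t S hadj hs hp ih =>
    have hwS := hp.left_mem
    have htS := hp.right_mem
    have hsw : s ≠ w := hadj.ne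
    have hst : s ≠ t := fun h => hs (h ▸ htS)
    have hwX : w ∉ X := fun h => hsw (hSX w (by simp [hwS]) h).symm
    have hsY : s ∉ Y := fun h => hst (hSY s (by simp) h)
    -- With `w` added to `X`, the paths for the rest of `S` start at `w` and at some `x₁ ∈ X`. Only
    -- if `x₁ = s` does prepending `s` to `A` fail.
    obtain ⟨x₁, hx₁, hx₁w, y, hy, hyt, A, B, hAB, hABX, hABY, hpath⟩ :=
      ih (X := insert w X) (by simp) htY (by grind) (by grind) ⟨s, by simp [hsX], hsw⟩ hY
    clear ih
    have hAB' : ∀ z ∈ A, z ∉ B := fun z hz => Finset.disjoint_left.1 hAB hz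
    have hx₁X : x₁ ∈ X := by grind
    have hwA : w ∈ A := by rcases hpath with h | h <;> exact h.1.left_mem
    have hxB : x₁ ∈ B := by rcases hpath with h | h <;> exact h.2.left_mem
    by_cases hx₁s : x₁ = s
    · subst hx₁s
      have hxA : x₁ ∉ A := Finset.disjoint_right.1 hAB hxB
      obtain ⟨x', hx', hx's⟩ := hX
      obtain ⟨T, hT, hsT⟩ := hG hx's hst.symm
      -- A new start `x` is found by a path `R` that avoids `s` and stops where it first meets `A`,
      -- `B` or `Y`.
      obtain ⟨x, hx, z, hz, R, hRT, hR, hRX, hRZ⟩ :=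
        hT.exists_trim (X := X) (Z := Y ∪ A ∪ B) hx' (by simp [htY])
      have hsR : x₁ ∉ R := fun h => hsT (hRT h)
      have hxR := hR.left_mem
      have hzR := hR.right_mem
      have hxs : x ≠ x₁ := fun h => hsR (h ▸ hxR)
      -- `R` continues along the tail of `A`, and `B` already starts at `s`.
      by_cases hzA : z ∈ A
      · have key : ∀ {e}, PathOn G w e A → ∃ A' ⊆ A, PathOn G x e (R ∪ A') := fun h => by
          obtain ⟨A₁, A₂, h₁, h₂, rfl, h₁₂⟩ := h.split hzA
          exact ⟨A₂, Finset.subset_union_right, hR.append h₂ (by grind)⟩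
        rcases hpath with h | h
        · obtain ⟨A', hA', hxt⟩ := key h.1
          exact ⟨x, hx, hxs, y, hy, hyt, B, R ∪ A',
            by rw [Finset.disjoint_left]; grind, by grind, by grind, .inr ⟨h.2, hxt⟩⟩
        · obtain ⟨A', hA', hxy⟩ := key h.1
          exact ⟨x, hx, hxs, y, hy, hyt, B, R ∪ A',
            by rw [Finset.disjoint_left]; grind, by grind, by grind, .inl ⟨h.2, hxy⟩⟩
      -- `R` continues along the tail of `B`, which avoids `s`; this frees `s` to be prepended to
      -- `A`.
      by_cases hzB : z ∈ B
      · have key : ∀ {e}, PathOn G x₁ e B → ∃ B' ⊆ B, x₁ ∉ B' ∧ PathOn G x e (R ∪ B') := fun h => by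
          obtain ⟨B₁, B₂, h₁, h₂, rfl, h₁₂⟩ := h.split hzB
          refine ⟨B₂, Finset.subset_union_right, fun h => hsR ?_, hR.append h₂ (by grind)⟩
          rwa [h₁₂ x₁ h₁.left_mem h]
        rcases hpath with h | h
        · obtain ⟨B', hB', hxB', hxy⟩ := key h.2
          exact ⟨x, hx, hxs, y, hy, hyt, insert x₁ A, R ∪ B',
            by rw [Finset.disjoint_left]; grind, by grind, by grind,
            .inl ⟨.cons hadj hxA h.1, hxy⟩⟩
        · obtain ⟨B', hB', hxB', hxt⟩ := key h.2
          exact ⟨x, hx, hxs, y, hy, hyt, insert x₁ A, R ∪ B',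
            by rw [Finset.disjoint_left]; grind, by grind, by grind,
            .inr ⟨.cons hadj hxA h.1, hxt⟩⟩
      -- `R` is itself the second path. The first is whichever of `A`, `B` ends at `t`; the other is
      -- dropped.
      have hzY : z ∈ Y := by grind
      have hzt : z ≠ t := by
        rintro rfl
        rcases hpath with h | h
        · exact hzA h.1.right_mem
        · exact hzB h.2.right_mem
      rcases hpath with h | h
      · have htA := h.1.right_mem
        have hyB := h.2.right_mem
        exact ⟨x, hx, hxs, z, hzY, hzt, insert x₁ A, R,
          by rw [Finset.disjoint_left]; grind, by grind, by grind,
          .inl ⟨.cons hadj hxA h.1, hR⟩⟩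
      · have htB := h.2.right_mem
        have hyA := h.1.right_mem
        exact ⟨x, hx, hxs, z, hzY, hzt, B, R,
          by rw [Finset.disjoint_left]; grind, by grind, by grind,
          .inl ⟨h.2, hR⟩⟩
    · have hsA : s ∉ A := fun h => by
        have := hABX s (by simp [h]) (by simp [hsX]); grind
      have hsB : s ∉ B := fun h => by
        have := hABX s (by simp [h]) (by simp [hsX]); grind
      refine ⟨x₁, hx₁X, hx₁s, y, hy, hyt, insert s A, B, by simp [hAB, hsB], by grind, by grind,
        ?_⟩
      exact hpath.imp (And.imp_left (.cons hadj hsA)) (And.imp_left (.cons hadj hsA))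

end Paths

/-! ### Degrees of the ends of a long path (Kopylov's lemma). -/

section LongPaths

variable {V : Type*} [DecidableEq V] {G : SimpleGraph V}

/-- The initial part of a path, rerouted along an edge at its first vertex so that it covers all
neighbours of that vertex. -/
theorem exists_rerouted_path {L : ℕ} {f : ℕ → V} (hf : ∀ i < L, G.Adj (f i) (f (i + 1)))
    (hinj : Set.InjOn f (Set.Iic L)) {p s : ℕ} (hps : p < s) (hsL : s ≤ L)
    (hs : G.Adj (f 0) (f s)) :
    ∃ T, PathOn G (f p) (f s) T ∧ (∀ z ∈ T, ∃ i ≤ s, z = f i) ∧ f 0 ∈ T ∧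
      ∀ i ≤ s, G.Adj (f 0) (f i) → f i ∈ T := by
  -- For the least such `i`, run back from `f p` to `f 0`, jump to `f i` and go on to `f s`. The
  -- skipped vertices, strictly between `p` and `i`, are not neighbours of `f 0`.
  have hex : ∃ i, p < i ∧ G.Adj (f 0) (f i) := ⟨s, hps, hs⟩
  classical
  obtain ⟨hpi, hi⟩ := Nat.find_spec hex
  have his : Nat.find hex ≤ s := Nat.find_min' hex ⟨hps, hs⟩
  have hmin : ∀ j, p < j → G.Adj (f 0) (f j) → Nat.find hex ≤ j :=
    fun j h h' => Nat.find_min' hex ⟨h, h'⟩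
  generalize Nat.find hex = i at *
  refine ⟨_, ((PathOn.segment hf hinj (Nat.zero_le p) (by omega)).reverse.append_edge hi
    (PathOn.segment hf hinj his hsL) ?_), ?_, ?_, ?_⟩
  · rw [Finset.disjoint_left]
    intro z hz hz'
    obtain ⟨a, ha, rfl⟩ := Finset.mem_image.1 hz
    obtain ⟨b, hb, hab⟩ := Finset.mem_image.1 hz'
    rw [Finset.mem_Icc] at ha hb
    have := hinj (show b ≤ L by omega) (show a ≤ L by omega) hab
    omega
  · intro z hz
    rw [← Finset.image_union, Finset.mem_image] at hz
    obtain ⟨a, ha, rfl⟩ := hz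
    rw [Finset.mem_union, Finset.mem_Icc, Finset.mem_Icc] at ha
    exact ⟨a, by omega, rfl⟩
  · exact Finset.mem_union_left _ (Finset.mem_image_of_mem _ (by simp))
  · intro j hj hadj
    rw [← Finset.image_union]
    refine Finset.mem_image_of_mem _ ?_
    rw [Finset.mem_union, Finset.mem_Icc, Finset.mem_Icc]
    by_cases hpj : p < j
    · exact .inr ⟨hmin j hpj hadj, hj⟩
    · exact .inl ⟨by omega, by omega⟩

/-- If a neighbour of the last vertex of a path precedes a neighbour of the first one,
then the path yields a long cycle. -/
theorem ShortCycles.card_add_card_lt_of_crossing {k : ℕ} (hG : ShortCycles G k) {L : ℕ}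
    {f : ℕ → V} (hf : ∀ i < L, G.Adj (f i) (f (i + 1))) (hinj : Set.InjOn f (Set.Iic L))
    (hkL : k ≤ L + 1) {I J : Finset ℕ}
    (hI : ∀ i, i ∈ I ↔ i ≤ L ∧ G.Adj (f 0) (f i)) (hJ : ∀ i, i ∈ J ↔ i ≤ L ∧ G.Adj (f L) (f i))
    (hIJ : ∃ j ∈ J, ∃ i ∈ I, j < i) : I.card + J.card < k := by
  -- A crossing pair with the fewest vertices `m` in its gap. The cycle through both crossing edges
  -- misses exactly that gap.
  have hex : ∃ m, ∃ j ∈ J, j + 1 + m ∈ I := by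
    obtain ⟨j, hj, i, hi, hji⟩ := hIJ
    exact ⟨i - (j + 1), j, hj, by rwa [Nat.add_sub_cancel' hji]⟩
  classical
  obtain ⟨j, hj, hi⟩ := Nat.find_spec hex
  have hmin : ∀ j' ∈ J, ∀ i' ∈ I, j' < i' → Nat.find hex ≤ i' - (j' + 1) := fun j' hj' i' hi' h =>
    Nat.find_min' hex ⟨j', hj', by rwa [Nat.add_sub_cancel' h]⟩
  generalize Nat.find hex = m at *
  obtain ⟨hjL, hjadj⟩ := (hJ j).1 hj
  obtain ⟨hiL, hiadj⟩ := (hI _).1 hi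
  have hcyc := hG ((PathOn.segment hf hinj (Nat.zero_le j) (by omega)).reverse.append_edge hiadj
    (PathOn.segment hf hinj hiL le_rfl) (by
      rw [Finset.disjoint_left]
      intro z hz hz'
      obtain ⟨a, ha, rfl⟩ := Finset.mem_image.1 hz
      obtain ⟨b, hb, hab⟩ := Finset.mem_image.1 hz'
      rw [Finset.mem_Icc] at ha hb
      have := hinj (show b ≤ L by omega) (show a ≤ L by omega) hab
      omega)) hjadj
  rw [← Finset.image_union, Finset.card_image_of_injOn] at hcyc
  swap
  · refine hinj.mono fun a ha => ?_
    simp only [Finset.coe_union, Finset.coe_Icc, Set.mem_union, Set.mem_Icc] at ha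
    show a ≤ L
    omega
  have h0I : 0 ∉ I := fun h => G.loopless.irrefl _ ((hI 0).1 h).2
  have hLJ : L ∉ J := fun h => G.loopless.irrefl _ ((hJ L).1 h).2
  -- With no gap the cycle would contain all `L + 1 ≥ k` vertices.
  rcases Nat.eq_zero_or_pos m with rfl | hm
  · rw [Finset.card_union_of_disjoint, Nat.card_Icc, Nat.card_Icc] at hcyc
    · omega
    · rw [Finset.disjoint_left]
      intro a ha hb
      rw [Finset.mem_Icc] at ha hb
      omega
  -- By minimality of the gap, the predecessors of `I` are disjoint from `J`, and all of these
  -- indices lie on the cycle and differ from `L`; only the predecessor of `j + 1 + m` falls into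
  -- the gap.
  have hcI : ((I.erase (j + 1 + m)).image (· - 1)).card = I.card - 1 := by
    rw [Finset.card_image_of_injOn, Finset.card_erase_of_mem hi]
    intro a ha b hb hab
    have ha0 : a ≠ 0 := fun h => h0I (h ▸ Finset.mem_of_mem_erase ha)
    have hb0 : b ≠ 0 := fun h => h0I (h ▸ Finset.mem_of_mem_erase hb)
    simp only at hab
    omega
  have hdisj : Disjoint ((I.erase (j + 1 + m)).image (· - 1)) J := by
    rw [Finset.disjoint_left]
    intro a ha haJ
    obtain ⟨i, hi', rfl⟩ := Finset.mem_image.1 ha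
    have hiI := Finset.mem_of_mem_erase hi'
    have hi0 : i ≠ 0 := fun h => h0I (h ▸ hiI)
    have := hmin _ haJ i hiI (by omega)
    omega
  have hsub : (I.erase (j + 1 + m)).image (· - 1) ∪ J ⊆
      (Finset.Icc 0 j ∪ Finset.Icc (j + 1 + m) L).erase L := by
    intro a ha
    rw [Finset.mem_erase, Finset.mem_union, Finset.mem_Icc, Finset.mem_Icc]
    rcases Finset.mem_union.1 ha with ha | ha
    · obtain ⟨i, hi', rfl⟩ := Finset.mem_image.1 ha
      have hiI := Finset.mem_of_mem_erase hi'
      have hine := Finset.ne_of_mem_erase hi'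
      have hi0 : i ≠ 0 := fun h => h0I (h ▸ hiI)
      have := ((hI i).1 hiI).1
      by_cases hji : j < i
      · have := hmin j hj i hiI hji
        omega
      · omega
    · have := ((hJ a).1 ha).1
      have haL : a ≠ L := fun h => hLJ (h ▸ ha)
      refine ⟨haL, ?_⟩
      by_contra! h
      have := hmin a ha _ hi (by omega)
      omega
  have hcard := Finset.card_le_card hsub
  rw [Finset.card_union_of_disjoint hdisj, hcI, Finset.card_erase_of_mem (by simp [hiL])] at hcard
  have hIpos := Finset.card_pos.2 ⟨_, hi⟩
  have : 0 < (Finset.Icc 0 j ∪ Finset.Icc (j + 1 + m) L).card :=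
    Finset.card_pos.2 ⟨0, by simp⟩
  omega

/-- Two disjoint paths between `X` and `Y` are closed to a cycle by a path in `X` and one in `Y`. -/
theorem ShortCycles.card_union_lt_of_disjoint_paths {k : ℕ} (hG : ShortCycles G k) {s t x y : V}
    {X Y T T' A B : Finset V} (hT : PathOn G x s T) (hT' : PathOn G y t T')
    (hTX : ∀ z ∈ T, z ∈ X) (hTY : ∀ z ∈ T', z ∈ Y) (hXY : ∀ z ∈ T, z ∈ T' → z = s ∧ z = t)
    (hxy : x ≠ y) (hxt : x ≠ t) (hAB : Disjoint A B)
    (hABX : ∀ z ∈ A ∪ B, z ∈ X → z = s ∨ z = x) (hABY : ∀ z ∈ A ∪ B, z ∈ Y → z = t ∨ z = y)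
    (hpath : PathOn G s t A ∧ PathOn G x y B ∨ PathOn G s y A ∧ PathOn G x t B) :
    ((T ∪ A ∪ T') ∪ B).card < k := by
  have hAB' : ∀ z ∈ A, z ∉ B := fun z hz => Finset.disjoint_left.1 hAB hz
  clear hAB
  simp only [Finset.mem_union] at hABX hABY
  rcases hpath with ⟨hA, hB⟩ | ⟨hA, hB⟩
  all_goals
    have hsA := hA.left_mem
    have htA := hA.right_mem
    have hxB := hB.left_mem
    have hyB := hB.right_mem
  · refine hG.card_union_lt ((hT.append hA ?_).append hT'.reverse ?_) hB hxy ?_ <;>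
      clear hT hT' hA hB hG <;> grind
  · refine hG.card_union_lt ((hT.append hA ?_).append hT' ?_) hB hxt ?_ <;>
      clear hT hT' hA hB hG <;> grind

/-- If all neighbours of the first vertex of a path precede those of the last vertex and no vertex
separates the graph, then the path yields a long cycle. -/
theorem ShortCycles.card_add_card_lt_of_not_crossing {k : ℕ} (hG : ShortCycles G k)
    (h2 : NoCutVertex G) {L : ℕ} (hL : 2 ≤ L)
    {f : ℕ → V} (hf : ∀ i < L, G.Adj (f i) (f (i + 1))) (hinj : Set.InjOn f (Set.Iic L))
    {I J : Finset ℕ}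
    (hI : ∀ i, i ∈ I ↔ i ≤ L ∧ G.Adj (f 0) (f i)) (hJ : ∀ i, i ∈ J ↔ i ≤ L ∧ G.Adj (f L) (f i))
    (hIJ : ∀ j ∈ J, ∀ i ∈ I, i ≤ j) : I.card + J.card < k := by
  have h1I : 1 ∈ I := (hI 1).2 ⟨by omega, hf 0 (by omega)⟩
  have h1J : L - 1 ∈ J := (hJ _).2 ⟨by omega, by
    have := (hf (L - 1) (by omega)).symm
    rwa [Nat.sub_add_cancel (by omega)] at this⟩
  obtain ⟨s, hsI, hs⟩ := I.exists_max_image id ⟨1, h1I⟩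
  obtain ⟨t, htJ, ht⟩ := J.exists_min_image id ⟨_, h1J⟩
  simp only [id] at hs ht
  have hst := hIJ t htJ s hsI
  have hs1 := hs _ h1I
  have ht1 := ht _ h1J
  obtain ⟨hsL, hsadj⟩ := (hI s).1 hsI
  obtain ⟨htL, htadj⟩ := (hJ t).1 htJ
  have heq : ∀ {a b}, a ≤ L → b ≤ L → f a = f b → a = b := fun ha hb h => hinj ha hb h
  have memX : ∀ {z}, z ∈ (Finset.Icc 0 s).image f ↔ ∃ i ≤ s, z = f i := by
    intro z; simp [eq_comm]
  have memY : ∀ {z}, z ∈ (Finset.Icc t L).image f ↔ ∃ i, (t ≤ i ∧ i ≤ L) ∧ z = f i := by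
    intro z; simp [eq_comm]
  obtain ⟨x, hx, hxs, y, hy, hyt, A, B, hAB, hABX, hABY, hpath⟩ := h2.exists_disjoint_paths
    (PathOn.segment hf hinj hst htL) (X := (Finset.Icc 0 s).image f)
    (Y := (Finset.Icc t L).image f) (memX.2 ⟨s, le_rfl, rfl⟩) (memY.2 ⟨t, ⟨le_rfl, htL⟩, rfl⟩)
    (by
      intro z hz hzX
      obtain ⟨a, ha, rfl⟩ := Finset.mem_image.1 hz
      obtain ⟨b, hb, hab⟩ := memX.1 hzX
      rw [Finset.mem_Icc] at ha
      have := heq (by omega) (by omega) hab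
      rw [show a = s by omega])
    (by
      intro z hz hzY
      obtain ⟨a, ha, rfl⟩ := Finset.mem_image.1 hz
      obtain ⟨b, hb, hab⟩ := memY.1 hzY
      rw [Finset.mem_Icc] at ha
      have := heq (by omega) (by omega) hab
      rw [show a = t by omega])
    ⟨f 0, memX.2 ⟨0, by omega, rfl⟩, fun h => by have := heq (by omega) hsL h; omega⟩
    ⟨f L, memY.2 ⟨L, by omega, rfl⟩, fun h => by have := heq le_rfl htL h; omega⟩
  obtain ⟨p, hp, rfl⟩ := memX.1 hx
  obtain ⟨q, hq, rfl⟩ := memY.1 hy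
  have hps : p ≠ s := fun h => hxs (by rw [h])
  have hqt : q ≠ t := fun h => hyt (by rw [h])
  obtain ⟨T, hT, hTX, hT0, hTI⟩ := exists_rerouted_path hf hinj (p := p) (by omega) hsL hsadj
  -- The same rerouting at the other end, on the reversed path.
  obtain ⟨T', hT', hTY, hTL, hTJ⟩ := exists_rerouted_path (G := G) (L := L) (f := fun i => f (L - i))
    (p := L - q) (s := L - t)
    (fun i hi => by
      have := (hf (L - (i + 1)) (by omega)).symm
      rwa [show L - (i + 1) + 1 = L - i by omega] at this)
    (fun a ha b hb hab => by
      have ha : a ≤ L := ha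
      have hb : b ≤ L := hb
      have := heq (by omega) (by omega) hab
      omega) (by omega) (by omega) (by
        simpa [Nat.sub_sub_self htL] using htadj)
  simp only [Nat.sub_sub_self htL, Nat.sub_sub_self hq.2, Nat.sub_zero] at hT' hTL hTJ
  have hTX' : ∀ z ∈ T, z ∈ (Finset.Icc 0 s).image f := fun z hz => memX.2 (hTX z hz)
  have hTY' : ∀ z ∈ T', z ∈ (Finset.Icc t L).image f := fun z hz => by
    obtain ⟨i, hi, rfl⟩ := hTY z hz
    exact memY.2 ⟨L - i, by omega, rfl⟩
  have hXY : ∀ z ∈ T, z ∈ T' → z = f s ∧ z = f t := fun z hz hz' => by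
    obtain ⟨i, hi, rfl⟩ := memX.1 (hTX' z hz)
    obtain ⟨j, hj, hij⟩ := memY.1 (hTY' _ hz')
    have := heq (by omega) (by omega) hij
    exact ⟨by rw [show i = s by omega], by rw [show i = t by omega]⟩
  have hpq : f p ≠ f q := fun h => by
    have := heq (by omega) (by omega) h
    omega
  have hpt : f p ≠ f t := fun h => by
    have := heq (by omega) (by omega) h
    omega
  have hlt : ((T ∪ A ∪ T') ∪ B).card < k := by
    exact hG.card_union_lt_of_disjoint_paths hT hT' hTX' hTY' hXY hpq hpt hAB hABX hABY hpath
  have h0I : 0 ∉ I := fun h => G.loopless.irrefl _ ((hI 0).1 h).2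
  have hLJ : L ∉ J := fun h => G.loopless.irrefl _ ((hJ L).1 h).2
  have hsub : (insert 0 I ∪ insert L J).image f ⊆ (T ∪ A ∪ T') ∪ B := by
    intro z hz
    obtain ⟨i, hi, rfl⟩ := Finset.mem_image.1 hz
    simp only [Finset.mem_union, Finset.mem_insert] at hi ⊢
    rcases hi with (rfl | hi) | (rfl | hi)
    · exact .inl (.inl (.inl hT0))
    · exact .inl (.inl (.inl (hTI i (hs i hi) ((hI i).1 hi).2)))
    · exact .inl (.inr hTL)
    · obtain ⟨hiL, hadj⟩ := (hJ i).1 hi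
      have := ht i hi
      have := hTJ (L - i) (by omega) (by rwa [Nat.sub_sub_self hiL])
      rw [Nat.sub_sub_self hiL] at this
      exact .inl (.inr this)
  have hcard := Finset.card_le_card hsub
  rw [Finset.card_image_of_injOn] at hcard
  swap
  · refine hinj.mono fun a ha => ?_
    simp only [Finset.coe_union, Finset.coe_insert, Set.mem_union, Set.mem_insert_iff,
      Finset.mem_coe, hI, hJ] at ha
    show a ≤ L
    omega
  -- The two closed neighbourhoods share an index only if `s = t`.
  have hinter : (insert 0 I ∩ insert L J).card ≤ 1 := by
    rw [Finset.card_le_one]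
    have key : ∀ a ∈ insert 0 I ∩ insert L J, a = s := by
      intro a ha
      simp only [Finset.mem_inter, Finset.mem_insert] at ha
      obtain ⟨rfl | ha, rfl | hb⟩ := ha
      · omega
      · have := ht _ hb; omega
      · have := hs _ ha; omega
      · have := hs _ ha; have := ht _ hb; omega
    intro a ha b hb
    rw [key a ha, key b hb]
  have := Finset.card_union_add_card_inter (insert 0 I) (insert L J)
  rw [Finset.card_insert_of_notMem h0I, Finset.card_insert_of_notMem hLJ] at this
  omega

/-- If neighbours of the two ends cross, a cycle can skip the gap between a closest crossing pair.
If not, two disjoint paths between the initial and final segments give a cycle through both closed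
neighbourhoods. -/
theorem ShortCycles.card_adj_add_card_adj_lt {k : ℕ} (hk : 3 ≤ k) (hG : ShortCycles G k)
    (h2 : NoCutVertex G) [DecidableRel G.Adj] {x y : V} {S : Finset V} (hS : PathOn G x y S)
    (hkS : k ≤ S.card) : (S.filter (G.Adj x)).card + (S.filter (G.Adj y)).card < k := by
  obtain ⟨L, f, rfl, rfl, hf, hinj, rfl⟩ := hS.exists_enum
  have hinj' : Set.InjOn f (Finset.range (L + 1)) :=
    hinj.mono fun a ha => Nat.lt_succ_iff.1 (Finset.mem_range.1 ha)
  rw [Finset.card_image_of_injOn hinj', Finset.card_range] at hkS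
  rw [Finset.filter_image, Finset.filter_image,
    Finset.card_image_of_injOn (hinj'.mono (Finset.coe_subset.2 (Finset.filter_subset _ _))),
    Finset.card_image_of_injOn (hinj'.mono (Finset.coe_subset.2 (Finset.filter_subset _ _)))]
  set I := (Finset.range (L + 1)).filter fun i => G.Adj (f 0) (f i) with hI
  set J := (Finset.range (L + 1)).filter fun i => G.Adj (f L) (f i) with hJ
  have hI' : ∀ i, i ∈ I ↔ i ≤ L ∧ G.Adj (f 0) (f i) := by simp [hI]
  have hJ' : ∀ i, i ∈ J ↔ i ≤ L ∧ G.Adj (f L) (f i) := by simp [hJ]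
  by_cases hIJ : ∃ j ∈ J, ∃ i ∈ I, j < i
  · exact hG.card_add_card_lt_of_crossing hf hinj hkS hI' hJ' hIJ
  · push Not at hIJ
    exact hG.card_add_card_lt_of_not_crossing h2 (by omega) hf hinj hI' hJ' hIJ

/-- In a graph in which non-adjacent vertices are joined by long paths, sets of vertices with
large minimum degrees are completely joined. -/
theorem ShortCycles.adj_of_minDegree [Fintype V] {k : ℕ} (hk : 3 ≤ k) (hG : ShortCycles G k)
    (h2 : NoCutVertex G) [DecidableRel G.Adj]
    (hsat : ∀ x y, x ≠ y → ¬ G.Adj x y → ∃ S, PathOn G x y S ∧ k ≤ S.card)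
    {A B : Finset V} {α β : ℕ} (hA : ∀ x ∈ A, α ≤ (A.filter (G.Adj x)).card)
    (hB : ∀ y ∈ B, β ≤ (B.filter (G.Adj y)).card) (hαβ : k ≤ α + β) :
    ∀ x ∈ A, ∀ y ∈ B, x ≠ y → G.Adj x y := by
  by_contra! hne
  obtain ⟨x₀, hx₀, y₀, hy₀, hne₀, hadj₀⟩ := hne
  obtain ⟨S₀, hS₀, hkS₀⟩ := hsat x₀ y₀ hne₀ hadj₀
  classical
  obtain ⟨⟨x, y, S⟩, hmem, hmax⟩ := (Finset.univ.filter fun p : V × V × Finset V =>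
      p.1 ∈ A ∧ p.2.1 ∈ B ∧ p.1 ≠ p.2.1 ∧ ¬ G.Adj p.1 p.2.1 ∧ PathOn G p.1 p.2.1 p.2.2 ∧
        k ≤ p.2.2.card).exists_max_image (fun p => p.2.2.card)
    ⟨(x₀, y₀, S₀), by simp_all⟩
  simp only [Finset.mem_filter, Finset.mem_univ, true_and, Prod.forall] at hmem hmax
  obtain ⟨hx, hy, hxy, hnadj, hS, hkS⟩ := hmem
  have hlt := hG.card_adj_add_card_adj_lt hk h2 hS hkS
  -- A neighbour of `x` in `A` off the path would extend it either to a long cycle or to a longer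
  -- path with non-adjacent ends.
  have h₁ : A.filter (G.Adj x) ⊆ S.filter (G.Adj x) := by
    intro z hz
    rw [Finset.mem_filter] at hz ⊢
    refine ⟨?_, hz.2⟩
    by_contra hzS
    have hp := PathOn.cons hz.2.symm hzS hS
    have hc := Finset.card_insert_of_notMem hzS
    by_cases hzy : G.Adj z y
    · have := hG hp hzy.symm
      omega
    · have := hmax z y _ ⟨hz.1, hy, fun h => hzS (h ▸ hS.right_mem), hzy, hp, by omega⟩
      omega
  have h₂ : B.filter (G.Adj y) ⊆ S.filter (G.Adj y) := by
    intro z hz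
    rw [Finset.mem_filter] at hz ⊢
    refine ⟨?_, hz.2⟩
    by_contra hzS
    have hp := hS.concat hz.2 hzS
    have hc := Finset.card_insert_of_notMem hzS
    by_cases hzx : G.Adj x z
    · have := hG hp hzx.symm
      omega
    · have := hmax x z _ ⟨hx, hz.1, fun h => hzS (h ▸ hS.left_mem), hzx, hp, by omega⟩
      omega
  have := hA x hx
  have := hB y hy
  have := Finset.card_le_card h₁
  have := Finset.card_le_card h₂
  omega

end LongPaths

/-! ### Counting cliques by deleting vertices, and cores. -/

section Counting

variable {V : Type*} {G : SimpleGraph V} {s : ℕ}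

open Classical in
/-- The `s`-cliques of `G` inside `U`. -/
noncomputable def cliquesIn (G : SimpleGraph V) (s : ℕ) (U : Finset V) : Finset (Finset V) :=
  (U.powersetCard s).filter fun K => G.IsClique (K : Set V)

theorem mem_cliquesIn {U K : Finset V} :
    K ∈ cliquesIn G s U ↔ (K ⊆ U ∧ K.card = s) ∧ G.IsClique (K : Set V) := by
  simp [cliquesIn, Finset.mem_powersetCard]

/-- The number of `s`-cliques of `G` inside `U`. -/
noncomputable def cliqueCount (G : SimpleGraph V) (s : ℕ) (U : Finset V) : ℕ :=
  (cliquesIn G s U).card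

theorem numCliques_eq_cliqueCount [Fintype V] :
    numCliques G s = cliqueCount G s Finset.univ := by
  rw [numCliques, cliqueCount, ← Set.ncard_coe_finset]
  congr 1
  ext K
  simp [SimpleGraph.isNClique_iff, and_comm, mem_cliquesIn]

theorem cliqueCount_le_choose (U : Finset V) : cliqueCount G s U ≤ U.card.choose s := by
  rw [cliqueCount, ← Finset.card_powersetCard]
  exact Finset.card_le_card fun K hK => Finset.mem_powersetCard.2 (mem_cliquesIn.1 hK).1

theorem cliqueCount_mono {H : SimpleGraph V} (hGH : G ≤ H) (U : Finset V) :
    cliqueCount G s U ≤ cliqueCount H s U := by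
  refine Finset.card_le_card fun K hK => ?_
  rw [mem_cliquesIn] at hK ⊢
  exact ⟨hK.1, hK.2.mono hGH⟩

theorem cliqueCount_erase [DecidableEq V] [DecidableRel G.Adj] (U : Finset V) (v : V) :
    cliqueCount G s U ≤
      cliqueCount G s (U.erase v) + (U.filter (G.Adj v)).card.choose (s - 1) := by
  rw [← Finset.card_powersetCard, cliqueCount, cliqueCount]
  refine le_trans ?_ (Nat.add_le_add_left (Finset.card_image_le (f := insert v)) _)
  refine le_trans (Finset.card_le_card fun K hK => ?_) (Finset.card_union_le _ _)
  obtain ⟨⟨hKU, hKs⟩, hK⟩ := mem_cliquesIn.1 hK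
  rw [Finset.mem_union, mem_cliquesIn, Finset.mem_image]
  by_cases hvK : v ∈ K
  · refine .inr ⟨K.erase v, ?_, Finset.insert_erase hvK⟩
    rw [Finset.mem_powersetCard, Finset.card_erase_of_mem hvK, hKs]
    refine ⟨fun z hz => ?_, rfl⟩
    rw [Finset.mem_erase] at hz
    rw [Finset.mem_filter]
    exact ⟨hKU hz.2, hK hvK hz.2 hz.1.symm⟩
  · exact .inl ⟨⟨Finset.subset_erase.2 ⟨hKU, hvK⟩, hKs⟩, hK⟩

theorem cliqueCount_le_numCliques_induce (A : Finset V) :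
    cliqueCount G s A ≤ numCliques (G.induce (A : Set V)) s := by
  classical
  rw [numCliques_eq_cliqueCount, cliqueCount, cliqueCount]
  refine le_trans (Finset.card_le_card fun K hK => ?_)
    (Finset.card_image_le (f := Finset.map (Function.Embedding.subtype (· ∈ (A : Set V)))))
  obtain ⟨⟨hKA, hKs⟩, hK⟩ := mem_cliquesIn.1 hK
  have hmap : (K.subtype (· ∈ (A : Set V))).map (Function.Embedding.subtype _) = K :=
    Finset.subtype_map_of_mem fun x hx => hKA hx
  refine Finset.mem_image.2 ⟨K.subtype (· ∈ (A : Set V)), mem_cliquesIn.2 ⟨⟨Finset.subset_univ _,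
    by rw [← hKs, ← Finset.card_map (Function.Embedding.subtype _), hmap]⟩, ?_⟩, hmap⟩
  intro a ha b hb hab
  exact hK (Finset.mem_subtype.1 ha) (Finset.mem_subtype.1 hb) fun h => hab (Subtype.ext h)

theorem cliqueCount_le_of_cover {U A B : Finset V}
    (h : ∀ K ⊆ U, G.IsClique (K : Set V) → K ⊆ A ∨ K ⊆ B) :
    cliqueCount G s U ≤ cliqueCount G s A + cliqueCount G s B := by
  classical
  refine le_trans (Finset.card_le_card fun K hK => ?_) (Finset.card_union_le _ _)
  obtain ⟨⟨hKU, hKs⟩, hK⟩ := mem_cliquesIn.1 hK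
  rw [Finset.mem_union, mem_cliquesIn, mem_cliquesIn]
  exact (h K hKU hK).imp (fun h => ⟨⟨h, hKs⟩, hK⟩) (fun h => ⟨⟨h, hKs⟩, hK⟩)

/-- Deleting vertices of degree at most `j` one after the other bounds the number of cliques. -/
theorem cliqueCount_le_of_degenerate [DecidableEq V] [DecidableRel G.Adj]
    {H : Finset V} {p j : ℕ} (h : ∀ U, H ⊆ U → p < U.card →
      ∃ v ∈ U, v ∉ H ∧ (U.filter (G.Adj v)).card ≤ j) {U : Finset V} (hHU : H ⊆ U)
    (hpU : p ≤ U.card) :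
    cliqueCount G s U ≤ p.choose s + (U.card - p) * j.choose (s - 1) := by
  obtain ⟨m, hm⟩ := Nat.exists_eq_add_of_le hpU
  induction m generalizing U with
  | zero => simpa [hm] using cliqueCount_le_choose (G := G) (s := s) U
  | succ m ih =>
    obtain ⟨v, hvU, hvH, hv⟩ := h U hHU (by omega)
    have hc := Finset.card_erase_of_mem hvU
    have h₁ := ih (U := U.erase v) (Finset.subset_erase.2 ⟨hHU, hvH⟩) (by omega) (by omega)
    have h₂ := cliqueCount_erase (G := G) (s := s) U v
    have h₃ := Nat.choose_le_choose (s - 1) hv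
    rw [show (U.erase v).card - p = m by omega] at h₁
    rw [show U.card - p = m + 1 by omega, Nat.succ_mul]
    omega

/-- A largest vertex set of minimum degree above `j`. -/
theorem exists_core [Fintype V] [DecidableEq V] (G : SimpleGraph V) [DecidableRel G.Adj] (j : ℕ) :
    ∃ H : Finset V, (∀ x ∈ H, j < (H.filter (G.Adj x)).card) ∧
      ∀ U, H ⊆ U → H.card < U.card → ∃ v ∈ U, v ∉ H ∧ (U.filter (G.Adj v)).card ≤ j := by
  obtain ⟨H, hH, hmax⟩ := (Finset.univ.filter fun H : Finset V =>
    ∀ x ∈ H, j < (H.filter (G.Adj x)).card).exists_max_image Finset.card ⟨∅, by simp⟩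
  rw [Finset.mem_filter] at hH
  refine ⟨H, hH.2, fun U hHU hlt => ?_⟩
  by_contra! hU
  refine absurd (hmax U (Finset.mem_filter.2 ⟨Finset.mem_univ _, fun x hx => ?_⟩)) (by omega)
  by_cases hxH : x ∈ H
  · exact (hH.2 x hxH).trans_le (Finset.card_le_card (Finset.filter_subset_filter _ hHU))
  · exact hU x hx hxH

end Counting

/-! ### Convexity of binomial coefficients and comparison with `psi`. -/

section Arithmetic

/-- `psi K s m` is the number of `s`-cliques of the graph on `m + 1` vertices whose blocks are
`m / K` cliques on `K + 1` vertices and one on `m % K + 1` vertices. -/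
def psi (K s m : ℕ) : ℕ := m / K * (K + 1).choose s + (m % K + 1).choose s

theorem choose_add_choose_le (m : ℕ) {x y : ℕ} (hxy : x ≤ y) (δ : ℕ) :
    (x + δ).choose m + y.choose m ≤ x.choose m + (y + δ).choose m := by
  cases m with
  | zero => simp
  | succ e =>
    induction δ with
    | zero => simp
    | succ δ ih =>
      have := Nat.choose_le_choose e (show x + δ ≤ y + δ by omega)
      rw [← Nat.add_assoc, ← Nat.add_assoc, Nat.choose_succ_succ, Nat.choose_succ_succ]
      simp only [Nat.succ_eq_add_one]
      omega

theorem two_mul_choose_le (m : ℕ) {i j d : ℕ} (h : 2 * d ≤ i + j) :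
    2 * d.choose m ≤ i.choose m + j.choose m := by
  wlog hij : i ≤ j generalizing i j
  · rw [add_comm]
    exact this (by omega) (by omega)
  by_cases hi : i ≤ d
  · have h₁ := choose_add_choose_le m hi (d - i)
    have h₂ := Nat.choose_le_choose m (show d + (d - i) ≤ j by omega)
    rw [Nat.add_sub_cancel' hi] at h₁
    omega
  · have h₁ := Nat.choose_le_choose m (show d ≤ i by omega)
    have h₂ := Nat.choose_le_choose m (show d ≤ j by omega)
    omega

variable {K s : ℕ}

theorem psi_of_lt {m : ℕ} (h : m < K) : psi K s m = (m + 1).choose s := by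
  simp [psi, Nat.div_eq_of_lt h, Nat.mod_eq_of_lt h]

theorem psi_add_self (hK : 0 < K) (m : ℕ) : psi K s (m + K) = psi K s m + (K + 1).choose s := by
  rw [psi, psi, Nat.add_div_right _ hK, Nat.add_mod_right, Nat.succ_mul]
  omega

theorem psi_mul_add {r t : ℕ} (ht : t < K) :
    psi K s (r * K + t) = r * (K + 1).choose s + (t + 1).choose s := by
  induction r with
  | zero => simp [psi_of_lt ht]
  | succ r ih =>
    rw [show (r + 1) * K + t = r * K + t + K by ring, psi_add_self (by omega), ih]
    ring

/-- Full blocks split off. For two partial blocks, convexity allows vertices to move from one to the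
other until one is full or the other is a single vertex, which carries no `s`-clique. -/
theorem psi_add_le (hK : 0 < K) (hs : 2 ≤ s) (a b : ℕ) :
    psi K s a + psi K s b ≤ psi K s (a + b) := by
  induction a using Nat.strong_induction_on generalizing b with
  | _ a iha =>
  by_cases ha : K ≤ a
  · obtain ⟨a, rfl⟩ := Nat.exists_eq_add_of_le' ha
    have := iha a (by omega) b
    rw [show a + K + b = a + b + K by ring, psi_add_self hK, psi_add_self hK]
    omega
  induction b using Nat.strong_induction_on with
  | _ b ihb =>
  by_cases hb : K ≤ b
  · obtain ⟨b, rfl⟩ := Nat.exists_eq_add_of_le' hb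
    have := ihb b (by omega)
    rw [show a + (b + K) = a + b + K by ring, psi_add_self hK, psi_add_self hK]
    omega
  push Not at ha hb
  rw [psi_of_lt ha, psi_of_lt hb]
  by_cases hab : a + b < K
  · rw [psi_of_lt hab]
    have := choose_add_choose_le s (show 1 ≤ b + 1 by omega) a
    rw [Nat.choose_eq_zero_of_lt (show 1 < s by omega)] at this
    rw [show a + 1 = 1 + a by omega, show a + b + 1 = b + 1 + a by omega]
    omega
  · obtain ⟨c, hc⟩ := Nat.exists_eq_add_of_le' (show K ≤ a + b by omega)
    rw [hc, psi_add_self hK, psi_of_lt (by omega)]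
    have := choose_add_choose_le s (show c + 1 ≤ b + 1 by omega) (a - c)
    rw [show c + 1 + (a - c) = a + 1 by omega, show b + 1 + (a - c) = K + 1 by omega] at this
    omega

theorem choose_succ_step (hs : 1 ≤ s) (j : ℕ) :
    (j + 1).choose s = j.choose (s - 1) + j.choose s := by
  obtain ⟨e, rfl⟩ := Nat.exists_eq_add_of_le' hs
  rfl

theorem choose_add_mul_le (hs : 1 ≤ s) {a x : ℕ} (hax : a ≤ x + 1) (i : ℕ) :
    (x + 1).choose s + i * a.choose (s - 1) ≤ (x + i + 1).choose s := by
  induction i with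
  | zero => simp
  | succ i ih =>
    rw [← Nat.add_assoc, choose_succ_step hs (x + i + 1), Nat.succ_mul]
    have := Nat.choose_le_choose (s - 1) (show a ≤ x + i + 1 by omega)
    omega

/-- The convex function `j ↦ C(j + 1, s)` lies above its supporting line of slope `C(a, s - 1)` at
`a`, written without subtraction. -/
theorem choose_tangent (hs : 1 ≤ s) (a j : ℕ) :
    (a + 1).choose s + j * a.choose (s - 1) ≤ (j + 1).choose s + a * a.choose (s - 1) := by
  rcases le_total a j with h | h
  · obtain ⟨i, rfl⟩ := Nat.exists_eq_add_of_le h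
    have := choose_add_mul_le hs (show a ≤ a + 1 by omega) i
    rw [Nat.add_mul]
    omega
  · obtain ⟨i, rfl⟩ := Nat.exists_eq_add_of_le h
    have : ∀ i' ≤ i, (j + i' + 1).choose s ≤ (j + 1).choose s + i' * (j + i).choose (s - 1) := by
      intro i' hi'
      induction i' with
      | zero => simp
      | succ i' ih =>
        have h₁ := ih (by omega)
        have h₂ := Nat.choose_le_choose (s - 1) (show j + i' + 1 ≤ j + i by omega)
        rw [← Nat.add_assoc, choose_succ_step hs (j + i' + 1), Nat.succ_mul]
        omega
    have := this i le_rfl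
    rw [Nat.add_mul]
    omega

/-- Raising `q` by one costs `2 * C(d, s - 1)` and gains `C(q + 1, s - 1) + C(K - q, s - 1)`, which
is enough because the upper entries sum to `K + 1 ≥ 2 * d`. -/
theorem choose_add_two_mul_le (hs : 1 ≤ s) {d : ℕ} (hd : 2 * d ≤ K + 1) {q : ℕ} (hq : q ≤ K) :
    (K - q + 1).choose s + 2 * q * d.choose (s - 1) ≤ (K + 1).choose s + (q + 1).choose s := by
  induction q with
  | zero => simp
  | succ q ih =>
    have h₁ := ih (by omega)
    have h₂ := two_mul_choose_le (s - 1) (show 2 * d ≤ (q + 1) + (K - q) by omega)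
    rw [choose_succ_step hs (q + 1)]
    rw [show K - q = K - (q + 1) + 1 by omega, choose_succ_step hs (K - (q + 1) + 1)] at h₁
    rw [show K - q = K - (q + 1) + 1 by omega] at h₂
    rw [show 2 * (q + 1) * d.choose (s - 1) =
      2 * q * d.choose (s - 1) + 2 * d.choose (s - 1) by ring]
    omega

theorem mul_choose_le (hs : 2 ≤ s) {d : ℕ} (hd : 2 * d ≤ K + 1) :
    K * d.choose (s - 1) ≤ (K + 1).choose s := by
  have := choose_add_two_mul_le (s := s) (by omega) hd le_rfl
  rw [Nat.sub_self, Nat.choose_eq_zero_of_lt (show 0 + 1 < s by omega), Nat.mul_assoc] at this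
  omega

theorem degenerate_le_psi (hK : 0 < K) (hs : 2 ≤ s) {d : ℕ} (hd : 2 * d ≤ K + 1) (m : ℕ) :
    (d + 1).choose s + m * d.choose (s - 1) ≤ psi K s m + d * d.choose (s - 1) := by
  induction m using Nat.strong_induction_on with
  | _ m ih =>
  by_cases hm : K ≤ m
  · obtain ⟨m, rfl⟩ := Nat.exists_eq_add_of_le' hm
    have h₁ := ih m (by omega)
    have h₂ := mul_choose_le hs hd
    rw [psi_add_self hK, Nat.add_mul]
    omega
  · rw [psi_of_lt (by omega)]
    exact choose_tangent (by omega) d m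

/-- The bound for a core on `h = K - q + 1` vertices, where `k = K + 2` and thus `k - h = q + 1`. -/
theorem clique_degenerate_le_psi (hK : 0 < K) (hs : 2 ≤ s) {d q : ℕ} (hd : 2 * d ≤ K + 1)
    (hq : q + 1 ≤ d) {m : ℕ} (hm : K - q ≤ m) :
    (K - q + 1).choose s + m * (q + 1).choose (s - 1) ≤
      psi K s m + (K - q) * (q + 1).choose (s - 1) := by
  have hc := Nat.choose_le_choose (s - 1) hq
  induction m using Nat.strong_induction_on with
  | _ m ih =>
  by_cases hmK : m < K
  · obtain ⟨i, rfl⟩ := Nat.exists_eq_add_of_le hm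
    have := choose_add_mul_le (s := s) (by omega) (show q + 1 ≤ K - q + 1 by omega) i
    rw [psi_of_lt hmK, Nat.add_mul]
    omega
  obtain ⟨j, rfl⟩ := Nat.exists_eq_add_of_le' (not_lt.1 hmK)
  rw [psi_add_self hK]
  -- Removing a block might leave fewer than `K - q`, so this range is treated directly: the tangent
  -- at `q + 1` for the partial block plus the exchange inequality for the full one.
  by_cases hj : j < K
  · have h₁ := choose_tangent (s := s) (by omega) (q + 1) j
    have h₂ := choose_add_two_mul_le (s := s) (by omega) hd (show q ≤ K by omega)
    have h₃ := Nat.mul_le_mul_left (2 * q) hc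
    rw [choose_succ_step (by omega) (q + 1), Nat.add_mul q] at h₁
    rw [psi_of_lt hj]
    obtain ⟨x, rfl⟩ := Nat.exists_eq_add_of_le (show q ≤ K by omega)
    rw [Nat.add_sub_cancel_left] at *
    generalize (q + 1).choose (s - 1) = c at *
    nlinarith
  · have h₁ := ih j (by omega) (by omega)
    have h₂ := mul_choose_le (s := s) hs (show 2 * (q + 1) ≤ K + 1 by omega)
    rw [Nat.add_mul]
    omega

/-- One step of the monotonicity of `C(j + 1, s) / j`. Strictness comes from `C(j + 1, s - 1) > 0`.
-/
theorem choose_mul_succ_le (hs : 2 ≤ s) {j : ℕ} (hj : 1 ≤ j) :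
    (j + 1).choose s * (j + 1) ≤ (j + 2).choose s * j ∧
      (s ≤ j + 2 → (j + 1).choose s * (j + 1) < (j + 2).choose s * j) := by
  have h₁ : 2 * (j + 1).choose s ≤ (j + 1).choose (s - 1) * j := by
    obtain ⟨e, rfl⟩ := Nat.exists_eq_add_of_le' (show 1 ≤ s by omega)
    rw [Nat.add_sub_cancel]
    have h₂ := Nat.choose_succ_right_eq (j + 1) e
    have h₃ := Nat.mul_le_mul_left ((j + 1).choose e) (show j + 1 - e ≤ j by omega)
    have h₄ := Nat.mul_le_mul_left ((j + 1).choose (e + 1)) (show 2 ≤ e + 1 by omega)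
    omega
  rw [choose_succ_step (by omega) (j + 1), Nat.add_mul, Nat.mul_succ]
  refine ⟨by omega, fun hsj => ?_⟩
  have := Nat.mul_pos (Nat.choose_pos (show s - 1 ≤ j + 1 by omega)) hj
  omega

theorem choose_mul_le (hs : 2 ≤ s) {t : ℕ} (ht : 1 ≤ t) (htK : t ≤ K) :
    (t + 1).choose s * K ≤ (K + 1).choose s * t := by
  induction K, htK using Nat.le_induction with
  | base => exact le_rfl
  | succ K htK ih =>
    have h₁ := (choose_mul_succ_le hs (ht.trans htK)).1
    refine Nat.le_of_mul_le_mul_right ?_ (ht.trans htK)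
    calc (t + 1).choose s * (K + 1) * K = (t + 1).choose s * K * (K + 1) := by ring
      _ ≤ (K + 1).choose s * t * (K + 1) := Nat.mul_le_mul_right _ ih
      _ = (K + 1).choose s * (K + 1) * t := by ring
      _ ≤ (K + 2).choose s * K * t := Nat.mul_le_mul_right _ h₁
      _ = (K + 1 + 1).choose s * t * K := by ring

theorem choose_mul_lt (hs : 2 ≤ s) {t : ℕ} (ht : 1 ≤ t) (htK : t < K) (hsK : s ≤ K + 1) :
    (t + 1).choose s * K < (K + 1).choose s * t := by
  obtain ⟨K, rfl⟩ := Nat.exists_eq_add_of_le' (show 1 ≤ K by omega)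
  have htK : t ≤ K := by omega
  have h₁ := (choose_mul_succ_le hs (ht.trans htK)).2 (by omega)
  refine Nat.lt_of_mul_lt_mul_right (a := K) ?_
  calc (t + 1).choose s * (K + 1) * K = (t + 1).choose s * K * (K + 1) := by ring
    _ ≤ (K + 1).choose s * t * (K + 1) := Nat.mul_le_mul_right _ (choose_mul_le hs ht htK)
    _ = (K + 1).choose s * (K + 1) * t := by ring
    _ < (K + 2).choose s * K * t := Nat.mul_lt_mul_of_pos_right h₁ ht
    _ = (K + 1 + 1).choose s * t * K := by ring

end Arithmetic

/-! ### Saturation, separating vertices and the core argument. -/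

section UpperBound

variable {V : Type*} [DecidableEq V] {G : SimpleGraph V} {k s : ℕ}

theorem PathOn.eq_singleton {u : V} {S : Finset V} (h : PathOn G u u S) : S = {u} := by
  cases h with
  | single => rfl
  | cons _ hu hp => exact absurd hp.right_mem hu

/-- Every graph without long cycles extends to one in which non-adjacent vertices are joined by
long paths. -/
theorem ShortCycles.exists_saturated [Finite V] (hk : 3 ≤ k) (hG : ShortCycles G k) :
    ∃ H, G ≤ H ∧ ShortCycles H k ∧
      ∀ x y, x ≠ y → ¬ H.Adj x y → ∃ S, PathOn H x y S ∧ k ≤ S.card := by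
  obtain ⟨H, hGH, hH⟩ := Finite.exists_le_maximal (p := fun H => ShortCycles H k) hG
  refine ⟨H, hGH, hH.prop, fun x y hxy hadj => ?_⟩
  have hlong : ¬ ShortCycles (H ⊔ SimpleGraph.edge x y) k := fun h => by
    refine hadj (hH.le_of_ge h le_sup_left ?_)
    simp [SimpleGraph.edge_adj, hxy]
  simp only [ShortCycles, not_forall, not_lt] at hlong
  obtain ⟨u, v, S, hS, huv, hkS⟩ := hlong
  have hcase : H.Adj v u ∨ (v = x ∧ u = y) ∨ (v = y ∧ u = x) := by
    rw [SimpleGraph.sup_adj, SimpleGraph.edge_adj] at huv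
    grind
  replace hS := hS.of_sup_edge
  rcases hS with hS | ⟨S₁, S₂, hd, rfl, hS⟩
  · rcases hcase with h | ⟨rfl, rfl⟩ | ⟨rfl, rfl⟩
    · have := hH.prop hS h
      omega
    · exact ⟨S, hS.reverse, hkS⟩
    · exact ⟨S, hS, hkS⟩
  · have hnot : ∀ {a b}, PathOn H a a S₁ → PathOn H b b S₂ → False := fun h₁ h₂ => by
      rw [h₁.eq_singleton, h₂.eq_singleton] at hkS
      have := hkS.trans Finset.card_le_two
      omega
    have hd' : ∀ {z}, z ∈ S₁ → z ∉ S₂ := fun h => Finset.disjoint_left.1 hd h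
    rcases hS with ⟨h₁, h₂⟩ | ⟨h₁, h₂⟩
    · rcases hcase with h | ⟨rfl, rfl⟩ | ⟨rfl, rfl⟩
      · exact ⟨_, h₁.reverse.append_edge h.symm h₂.reverse hd, hkS⟩
      · exact absurd h₂.left_mem (hd' h₁.left_mem)
      · exact (hnot h₁ h₂).elim
    · rcases hcase with h | ⟨rfl, rfl⟩ | ⟨rfl, rfl⟩
      · exact ⟨_, h₂.append_edge h h₁ hd.symm, by rwa [Finset.union_comm]⟩
      · exact (hnot h₁ h₂).elim
      · exact absurd h₂.left_mem (hd' h₁.left_mem)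

/-- A graph with a separating vertex is covered by two smaller parts which share only that vertex. -/
theorem exists_cover_of_not_noCutVertex [Fintype V] (h : ¬ NoCutVertex G) :
    ∃ A B : Finset V, A.Nonempty ∧ B.Nonempty ∧ A.card < Fintype.card V ∧
      B.card < Fintype.card V ∧ A.card + B.card = Fintype.card V + 1 ∧
      ∀ K : Finset V, G.IsClique (K : Set V) → K ⊆ A ∨ K ⊆ B := by
  classical
  simp only [NoCutVertex, not_forall, not_exists, not_and, not_not] at h
  obtain ⟨w, u, v, hu, hv, hsep⟩ := h
  -- The component of `u` after deleting `w`. The parts are `C` with `w`, and the complement of `C`,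
  -- which also contains `w`.
  set C : Finset V := Finset.univ.filter fun z => ∃ S, PathOn G u z S ∧ w ∉ S with hC
  have memC : ∀ {z}, z ∈ C ↔ ∃ S, PathOn G u z S ∧ w ∉ S := by simp [hC]
  have huC : u ∈ C := memC.2 ⟨{u}, .single u, by simpa using hu.symm⟩
  have hvC : v ∉ C := fun h => by
    obtain ⟨S, hS, hw⟩ := memC.1 h
    exact hw (hsep S hS)
  have hwC : w ∉ C := fun h => by
    obtain ⟨S, hS, hw⟩ := memC.1 h
    exact hw hS.right_mem
  have hadj : ∀ z ∈ C, ∀ y ∉ C, y ≠ w → ¬ G.Adj z y := by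
    intro z hz y hy hyw hzy
    obtain ⟨S, hS, hw⟩ := memC.1 hz
    refine hy (memC.2 ?_)
    by_cases hyS : y ∈ S
    · obtain ⟨S₁, S₂, h₁, -, rfl, -⟩ := hS.split hyS
      exact ⟨S₁, h₁, fun h => hw (Finset.mem_union_left _ h)⟩
    · exact ⟨_, hS.concat hzy hyS, by simp [hw, hyw.symm]⟩
  have h₁ := Finset.card_compl_add_card C
  have h₂ := Finset.card_insert_of_notMem hwC
  refine ⟨insert w C, Cᶜ, ⟨w, by simp⟩, ⟨w, by simpa using hwC⟩, ?_, ?_, by omega, ?_⟩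
  · rw [← Finset.card_univ]
    exact Finset.card_lt_card (Finset.ssubset_univ_iff.2 fun h => by
      have := h ▸ Finset.mem_univ v
      simp [hv, hvC] at this)
  · have := Finset.card_pos.2 ⟨u, huC⟩
    omega
  · intro K hK
    by_contra! hcon
    obtain ⟨y, hyK, hy⟩ := Finset.not_subset.1 hcon.1
    obtain ⟨z, hzK, hz⟩ := Finset.not_subset.1 hcon.2
    simp only [Finset.mem_insert, not_or, Finset.mem_compl, not_not] at hy hz
    exact hadj z hz y hy.2 hy.1 (hK hzK hyK fun h => hy.2 (h ▸ hz))

theorem exists_pathOn_of_isClique {K : Finset V} {a : V} (ha : a ∉ K)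
    (hK : G.IsClique (insert a K : Finset V)) : ∃ v ∈ insert a K, PathOn G a v (insert a K) := by
  induction K using Finset.induction_on generalizing a with
  | empty => exact ⟨a, by simp, by simpa using PathOn.single (G := G) a⟩
  | @insert b K hb ih =>
    obtain ⟨v, hv, hp⟩ := ih hb (hK.subset (by simp))
    refine ⟨v, Finset.mem_insert_of_mem hv, .cons (hK (by simp) (by simp) ?_) ha hp⟩
    rintro rfl
    exact ha (by simp)

/-- A path through all of the clique has adjacent ends. -/
theorem ShortCycles.card_lt_of_isClique (hk : 2 ≤ k) (hG : ShortCycles G k) {K : Finset V}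
    (hK : G.IsClique (K : Set V)) : K.card < k := by
  by_contra! hcard
  obtain ⟨a, ha, b, hb, hab⟩ := Finset.one_lt_card.1 (show 1 < K.card by omega)
  have hbK : b ∈ K.erase a := Finset.mem_erase.2 ⟨hab.symm, hb⟩
  have e : insert b ((K.erase a).erase b) = K.erase a := Finset.insert_erase hbK
  obtain ⟨v, hv, hp⟩ := exists_pathOn_of_isClique (G := G) (Finset.notMem_erase b (K.erase a))
    (hK.subset (by rw [e]; exact Finset.coe_subset.2 (Finset.erase_subset _ _)))
  rw [e] at hp hv
  have hv' := Finset.mem_erase.1 hv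
  have := hG (.cons (hK ha hb hab) (Finset.notMem_erase a K) hp) (hK hv'.2 ha hv'.1)
  rw [Finset.insert_erase ha] at this
  omega

/-- Kopylov's bound in terms of the size `h` of the core. -/
theorem ShortCycles.cliqueCount_le_of_saturated [Fintype V] (hk : 3 ≤ k) (hG : ShortCycles G k)
    (h2 : NoCutVertex G)
    (hsat : ∀ x y, x ≠ y → ¬ G.Adj x y → ∃ S, PathOn G x y S ∧ k ≤ S.card)
    (hkV : k ≤ Fintype.card V) {d : ℕ} (hd : k ≤ 2 * (d + 1)) (hdk : d + 1 ≤ k) :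
    cliqueCount G s Finset.univ ≤
        (d + 1).choose s + (Fintype.card V - (d + 1)) * d.choose (s - 1) ∨
      ∃ h, d + 2 ≤ h ∧ h < k ∧ cliqueCount G s Finset.univ ≤
        h.choose s + (Fintype.card V - h) * (k - h).choose (s - 1) := by
  classical
  obtain ⟨H, hH, hHmax⟩ := exists_core G d
  rcases H.eq_empty_or_nonempty with rfl | ⟨x, hx⟩
  · refine .inl ?_
    rw [← Finset.card_univ]
    exact cliqueCount_le_of_degenerate (H := ∅) (p := d + 1)
      (fun U hU hlt => hHmax U hU (by rw [Finset.card_empty]; omega))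
      (Finset.empty_subset _) (by rw [Finset.card_univ]; omega)
  · have hHadj := hG.adj_of_minDegree hk h2 hsat (fun x hx => hH x hx) (fun x hx => hH x hx)
      (by omega)
    have hdeg : ∀ y ∈ H, (H.filter (G.Adj y)).card = H.card - 1 := fun y hy => by
      rw [← Finset.card_erase_of_mem hy]
      congr 1
      ext z
      rw [Finset.mem_filter, Finset.mem_erase]
      exact ⟨fun h => ⟨h.2.ne', h.1⟩, fun h => ⟨h.2, hHadj y hy z h.2 h.1.symm⟩⟩
    have hdH : d + 2 ≤ H.card := by
      have := hH x hx
      rw [hdeg x hx] at this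
      omega
    have hHk : H.card < k := hG.card_lt_of_isClique (by omega)
      fun y hy z hz hyz => hHadj y hy z hz hyz
    refine .inr ⟨H.card, hdH, hHk, ?_⟩
    -- Degrees `h - 1` in `H` and at least `k - h + 1` in `H'` sum to `k`, so `H'` is completely
    -- joined to `H`. A vertex of `H'` outside `H` would have degree above `d` in `insert y H`,
    -- against the maximality of `H`.
    obtain ⟨H', hH', hH'max⟩ := exists_core G (k - H.card)
    have hHH' := hG.adj_of_minDegree hk h2 hsat (fun x hx => (hdeg x hx).ge)
      (fun x hx => Nat.succ_le_of_lt (hH' x hx)) (by omega)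
    have hsub : H' ⊆ H := by
      intro y hy
      by_contra hyH
      obtain ⟨v, hv, hvH, hvd⟩ := hHmax (insert y H) (Finset.subset_insert _ _)
        (by rw [Finset.card_insert_of_notMem hyH]; omega)
      obtain rfl : v = y := by simpa [hvH] using hv
      have : H ⊆ (insert v H).filter (G.Adj v) := fun z hz => Finset.mem_filter.2
        ⟨Finset.mem_insert_of_mem hz, (hHH' z hz v hy fun h => hvH (h ▸ hz)).symm⟩
      have := Finset.card_le_card this
      omega
    have hcard := Finset.card_le_card hsub
    rw [← Finset.card_univ]
    exact cliqueCount_le_of_degenerate (H := H') (fun U hU hlt => hH'max U hU (by omega))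
      (Finset.subset_univ _) (by rw [Finset.card_univ]; omega)

end UpperBound

/-- Stated for nonempty graphs, so that the induction applies to both sides of a separating vertex
without any check of connectedness. -/
theorem ShortCycles.numCliques_le_psi {k s : ℕ} (hk : 4 ≤ k) (hs : 2 ≤ s) {V : Type*}
    [Fintype V] [DecidableEq V] [Nonempty V] {G : SimpleGraph V} (hG : ShortCycles G k) :
    numCliques G s ≤ psi (k - 2) s (Fintype.card V - 1) := by
  induction hn : Fintype.card V using Nat.strong_induction_on generalizing V with
  | _ n ih =>
  have hpos : 0 < Fintype.card V := Fintype.card_pos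
  rw [numCliques_eq_cliqueCount]
  obtain ⟨H, hGH, hH, hsat⟩ := hG.exists_saturated (by omega)
  refine (cliqueCount_mono hGH _).trans ?_
  by_cases hnk : n < k
  · refine (cliqueCount_le_choose _).trans ?_
    rw [Finset.card_univ, hn]
    by_cases hnk' : n - 1 < k - 2
    · rw [psi_of_lt hnk', Nat.sub_add_cancel (by omega)]
    · have := psi_add_self (s := s) (show 0 < k - 2 by omega) 0
      rw [Nat.zero_add] at this
      rw [show n - 1 = k - 2 by omega, this, show k - 2 + 1 = n by omega]
      exact Nat.le_add_left _ _
  by_cases h2 : NoCutVertex H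
  · rcases hH.cliqueCount_le_of_saturated (s := s) (d := (k - 1) / 2) (by omega) h2 hsat
      (by omega) (by omega) (by omega) with h | ⟨j, hdj, hjk, h⟩
    · refine h.trans ?_
      have := degenerate_le_psi (K := k - 2) (d := (k - 1) / 2) (by omega) hs (by omega) (n - 1)
      have := Nat.mul_le_mul_right (((k - 1) / 2).choose (s - 1))
        (show (k - 1) / 2 ≤ n - 1 by omega)
      rw [hn, show n - ((k - 1) / 2 + 1) = n - 1 - (k - 1) / 2 by omega, Nat.sub_mul]
      omega
    · refine h.trans ?_
      have := clique_degenerate_le_psi (K := k - 2) (d := (k - 1) / 2) (q := k - j - 1) (m := n - 1)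
        (by omega) hs (by omega) (by omega) (by omega)
      rw [show k - 2 - (k - j - 1) = j - 1 by omega, show k - j - 1 + 1 = k - j by omega,
        Nat.sub_add_cancel (by omega)] at this
      have := Nat.mul_le_mul_right ((k - j).choose (s - 1)) (show j - 1 ≤ n - 1 by omega)
      rw [hn, show n - j = n - 1 - (j - 1) by omega, Nat.sub_mul]
      omega
  · obtain ⟨A, B, hA, hB, hAn, hBn, hAB, hcov⟩ := exists_cover_of_not_noCutVertex h2
    have key : ∀ A : Finset V, A.Nonempty → A.card < Fintype.card V →
        cliqueCount H s A ≤ psi (k - 2) s (A.card - 1) := fun A hA hAn => by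
      have : Nonempty (A : Set V) := hA.to_subtype
      have e : Fintype.card (A : Set V) = A.card := by simp
      exact (cliqueCount_le_numCliques_induce A).trans
        (ih A.card (by omega) (hH.induce (A : Set V)) e)
    refine (cliqueCount_le_of_cover fun K _ hK => hcov K hK).trans ?_
    refine (Nat.add_le_add (key A hA hAn) (key B hB hBn)).trans ?_
    refine (psi_add_le (by omega) hs _ _).trans (le_of_eq ?_)
    have := hA.card_pos
    have := hB.card_pos
    congr 1
    omega

/-! ### The extremal graph `graphQ`. -/

section GraphQ

variable {n k s r t : ℕ}

theorem graphQ_connected (hn : 0 < n) : (graphQ n k).Connected := by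
  have h0 : ∀ v : Fin n, (graphQ n k).Reachable ⟨0, hn⟩ v := fun v => by
    by_cases hv : (⟨0, hn⟩ : Fin n) = v
    · rw [hv]
    · exact SimpleGraph.Adj.reachable ⟨hv, .inl rfl⟩
  have : Nonempty (Fin n) := ⟨⟨0, hn⟩⟩
  exact ⟨fun u v => (h0 u).symm.trans (h0 v)⟩

/-- Vertex `0` is the only passage between blocks, and here it can occur only as the last vertex. -/
theorem graphQ_block_eq_of_walk {u v : Fin n} (p : (graphQ n k).Walk u v) (hp : p.IsPath)
    (hu : u.val ≠ 0) (h0 : ∀ z ∈ p.support, z.val = 0 → z = v) :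
    ∀ x ∈ p.support, x.val ≠ 0 → (x.val - 1) / (k - 2) = (u.val - 1) / (k - 2) := by
  induction p with
  | nil => simp_all
  | @cons u w v hadj q ih =>
    intro x hx hx0
    rcases List.mem_cons.1 (SimpleGraph.Walk.support_cons hadj q ▸ hx) with rfl | hxq
    · rfl
    have hq := (SimpleGraph.Walk.cons_isPath_iff _ _).1 hp
    by_cases hw : w.val = 0
    · obtain rfl : w = v := h0 w (by simp) hw
      obtain rfl : x = w := by
        simpa [SimpleGraph.Walk.nil_iff_support_eq.1 (SimpleGraph.Walk.isPath_iff_nil.1 hq.1)]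
          using hxq
      exact absurd hw hx0
    · rw [ih hq.1 hw (fun z hz => h0 z (by simp [hz])) x hxq hx0]
      rcases hadj.2 with h | h | h
      · exact absurd h hu
      · exact absurd h hw
      · exact h.symm

theorem card_le_of_same_block (hk : 3 ≤ k) (b : ℕ) (S : Finset (Fin n))
    (hS : ∀ x ∈ S, x.val ≠ 0 → (x.val - 1) / (k - 2) = b) : S.card ≤ k - 1 := by
  have hsub : S.image Fin.val ⊆
      insert 0 (Finset.Ico (b * (k - 2) + 1) (b * (k - 2) + 1 + (k - 2))) := by
    intro i hi
    obtain ⟨x, hx, rfl⟩ := Finset.mem_image.1 hi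
    rw [Finset.mem_insert, Finset.mem_Ico]
    by_cases hx0 : x.val = 0
    · exact .inl hx0
    · have hxb := hS x hx hx0
      rw [Nat.div_eq_iff (by omega)] at hxb
      have := Nat.succ_mul b (k - 2)
      omega
  have h₁ := Finset.card_le_card hsub
  rw [Finset.card_image_of_injective _ Fin.val_injective] at h₁
  have h₂ := Finset.card_insert_le 0 (Finset.Ico (b * (k - 2) + 1) (b * (k - 2) + 1 + (k - 2)))
  rw [Nat.card_Ico] at h₂
  omega

theorem graphQ_noCycle (hk : 3 ≤ k) : NoCycleOfLengthAtLeast (graphQ n k) k := by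
  have key : ∀ (v : Fin n) (c : (graphQ n k).Walk v v), c.IsCycle →
      (∀ z ∈ c.support, z.val = 0 → z = v) → c.length < k := by
    intro v c hc h0
    cases c with
    | nil => exact absurd rfl hc.ne_nil
    | @cons _ w _ hadj q =>
      have hq := ((SimpleGraph.Walk.cons_isCycle_iff _ _).1 hc).1
      have hcard : q.support.toFinset.card = q.length + 1 := by
        rw [List.toFinset_card_of_nodup hq.support_nodup, SimpleGraph.Walk.length_support]
      have hw : w.val ≠ 0 := fun h => hadj.ne (h0 w (by simp) h).symm
      have := card_le_of_same_block hk ((w.val - 1) / (k - 2)) q.support.toFinset fun x hx hx0 =>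
        graphQ_block_eq_of_walk q hq hw (fun z hz => h0 z (by simp [hz])) x
          (List.mem_toFinset.1 hx) hx0
      rw [SimpleGraph.Walk.length_cons]
      omega
  intro v c hc
  by_cases h : ∃ z ∈ c.support, z.val = 0
  · obtain ⟨z, hz, hz0⟩ := h
    -- A cycle through `0` is rotated to start there; the rest of it is then a path that meets `0`
    -- only at its end.
    rw [← c.length_rotate z hz]
    exact key z _ (hc.rotate hz) fun y _ hy => Fin.ext (hy.trans hz0.symm)
  · push Not at h
    exact key v c hc fun z hz hz0 => absurd hz0 (h z hz)

/-- The vertex `0` of `graphQ n k` together with its block number `b`. -/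
def blockQ (n k b : ℕ) : Finset (Fin n) :=
  Finset.univ.filter fun x => x.val = 0 ∨ (x.val - 1) / (k - 2) = b

theorem le_card_blockQ {b m : ℕ} (hm : m ≤ k - 2) (hb : b * (k - 2) + m < n) :
    m + 1 ≤ (blockQ n k b).card := by
  have hsub : insert 0 (Finset.Ico (b * (k - 2) + 1) (b * (k - 2) + 1 + m)) ⊆
      (blockQ n k b).image Fin.val := by
    intro i hi
    rw [Finset.mem_insert, Finset.mem_Ico] at hi
    refine Finset.mem_image.2 ⟨⟨i, by omega⟩, ?_, rfl⟩
    rw [blockQ, Finset.mem_filter]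
    refine ⟨Finset.mem_univ _, hi.imp_right fun hi => ?_⟩
    have := Nat.succ_mul b (k - 2)
    change (i - 1) / (k - 2) = b
    rw [Nat.div_eq_iff (by omega)]
    omega
  have h := Finset.card_le_card hsub
  rw [Finset.card_image_of_injective _ Fin.val_injective,
    Finset.card_insert_of_notMem (by simp), Nat.card_Ico] at h
  omega

/-- Distinct blocks share only vertex `0`, so no `s`-set with `s ≥ 2` is counted twice. -/
theorem le_numCliques_graphQ (hk : 3 ≤ k) (hs : 2 ≤ s) (hn : n = r * (k - 2) + t + 1)
    (ht : t < k - 2) :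
    r * (k - 1).choose s + (t + 1).choose s ≤ numCliques (graphQ n k) s := by
  have hdisj : ∀ b b', b ≠ b' → Disjoint ((blockQ n k b).powersetCard s)
      ((blockQ n k b').powersetCard s) := by
    intro b b' hbb
    rw [Finset.disjoint_left]
    intro K hK hK'
    rw [Finset.mem_powersetCard] at hK hK'
    have hK1 : K.card ≤ 1 := Finset.card_le_one.2 fun x hx y hy => by
      have hx₁ := hK.1 hx
      have hx₂ := hK'.1 hx
      have hy₁ := hK.1 hy
      have hy₂ := hK'.1 hy
      simp only [blockQ, Finset.mem_filter, Finset.mem_univ, true_and] at hx₁ hx₂ hy₁ hy₂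
      exact Fin.ext (by omega)
    omega
  have hsub : (Finset.range (r + 1)).biUnion (fun b => (blockQ n k b).powersetCard s) ⊆
      cliquesIn (graphQ n k) s Finset.univ := by
    intro K hK
    obtain ⟨b, -, hK⟩ := Finset.mem_biUnion.1 hK
    rw [Finset.mem_powersetCard] at hK
    refine mem_cliquesIn.2 ⟨⟨Finset.subset_univ _, hK.2⟩, fun x hx y hy hxy => ⟨hxy, ?_⟩⟩
    have hx := hK.1 hx
    have hy := hK.1 hy
    simp only [blockQ, Finset.mem_filter, Finset.mem_univ, true_and] at hx hy
    omega
  have hcard := Finset.card_le_card hsub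
  rw [Finset.card_biUnion fun b _ b' _ h => hdisj b b' h, Finset.sum_range_succ] at hcard
  simp only [Finset.card_powersetCard] at hcard
  rw [numCliques_eq_cliqueCount]
  refine le_trans ?_ hcard
  refine Nat.add_le_add ?_ (Nat.choose_le_choose s (le_card_blockQ ht.le (by omega)))
  calc r * (k - 1).choose s = ∑ _b ∈ Finset.range r, (k - 1).choose s := by simp
    _ ≤ _ := Finset.sum_le_sum fun b hb => Nat.choose_le_choose s ?_
  have hbr := Nat.mul_le_mul_right (k - 2) (Nat.succ_le_of_lt (Finset.mem_range.1 hb))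
  rw [Nat.succ_mul] at hbr
  have := le_card_blockQ (n := n) (k := k) (b := b) le_rfl (by omega)
  omega

end GraphQ

end CliqueCircumference

theorem theorem2p2 (n k s r t : ℕ) (hn : 2 ≤ n) (hk : 4 ≤ k) (hs : 2 ≤ s)
    (hnrt : n - 1 = r * (k - 2) + t) (ht : t ≤ k - 3) :
    -- the bound for every connected `n`-vertex graph without cycles of length at least `k`
    (∀ {V : Type*} [Fintype V] (G : SimpleGraph V), Fintype.card V = n → G.Connected →
      CliqueCircumference.NoCycleOfLengthAtLeast G k →
      CliqueCircumference.numCliques G s ≤ r * (k - 1).choose s + (t + 1).choose s) ∧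
    -- it is at most `(n - 1) / (k - 2) * C(k - 1, s)`, and less than that if `k - 2` does not divide
    -- `n - 1` and `s ≤ k - 1`
    (((r * (k - 1).choose s + (t + 1).choose s : ℕ) : ℝ)
        ≤ ((n : ℝ) - 1) / ((k : ℝ) - 2) * ((k - 1).choose s : ℝ) ∧
      (t ≠ 0 → s ≤ k - 1 →
        ((r * (k - 1).choose s + (t + 1).choose s : ℕ) : ℝ)
          < ((n : ℝ) - 1) / ((k : ℝ) - 2) * ((k - 1).choose s : ℝ))) ∧
    -- it is attained by `Q_{n,k}`
    ((CliqueCircumference.graphQ n k).Connected ∧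
      CliqueCircumference.NoCycleOfLengthAtLeast (CliqueCircumference.graphQ n k) k ∧
      CliqueCircumference.numCliques (CliqueCircumference.graphQ n k) s
        = r * (k - 1).choose s + (t + 1).choose s) := by
  obtain ⟨K, rfl⟩ := Nat.exists_eq_add_of_le' (show 2 ≤ k by omega)
  have hpsi : CliqueCircumference.psi K s (n - 1) =
      r * (K + 2 - 1).choose s + (t + 1).choose s := by
    rw [hnrt, Nat.add_sub_cancel, CliqueCircumference.psi_mul_add (by omega)]
    rfl
  refine ⟨?_, ?_, CliqueCircumference.graphQ_connected (by omega),
    CliqueCircumference.graphQ_noCycle (by omega), le_antisymm ?_ ?_⟩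
  · intro V _ G hV hconn hG
    classical
    have := hconn.nonempty
    rw [← hpsi, ← hV]
    exact (hG.shortCycles (by omega)).numCliques_le_psi hk hs
  · have hn' : (n : ℝ) - 1 = r * K + t := by
      have : n = r * (K + 2 - 2) + t + 1 := by omega
      rw [Nat.add_sub_cancel] at this
      rw [this]
      push_cast
      ring
    have hK : (0 : ℝ) < K := by exact_mod_cast (show 0 < K by omega)
    -- The full blocks contribute equally to both sides, which leaves `C(t + 1, s)` against `C(K +
    -- 1, s) * t / K`.
    have e : ((n : ℝ) - 1) / (((K + 2 : ℕ) : ℝ) - 2) * ((K + 2 - 1).choose s : ℝ) =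
        r * (K + 1).choose s + (K + 1).choose s * t / K := by
      rw [hn']
      push_cast
      rw [show (K : ℝ) + 2 - 2 = K by ring]
      field_simp
    rw [e, show K + 2 - 1 = K + 1 by omega]
    push_cast
    constructor
    · rw [add_le_add_iff_left, le_div_iff₀ hK]
      rcases Nat.eq_zero_or_pos t with rfl | ht0
      · simp [Nat.choose_eq_zero_of_lt (show 1 < s by omega)]
      · exact_mod_cast CliqueCircumference.choose_mul_le hs ht0 (by omega)
    · intro ht0 hsk
      rw [add_lt_add_iff_left, lt_div_iff₀ hK]
      exact_mod_cast CliqueCircumference.choose_mul_lt hs (by omega) (by omega) (by omega)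
  · rw [← hpsi]
    have : Nonempty (Fin n) := ⟨⟨0, by omega⟩⟩
    simpa using ((CliqueCircumference.graphQ_noCycle (n := n) (by omega)).shortCycles
      (by omega)).numCliques_le_psi hk hs
  · exact CliqueCircumference.le_numCliques_graphQ (by omega) hs (by omega) (by omega)
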